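/- A *random projector* is a random $k\times m$ matrix $T$ of one of the following four kinds: (1) $T=\sqrt{m/k}\,Q$, where the rows of $Q$ form an orthonormal basis of a uniformly distributed random $k$-dimensional linear subspace of $\mathbb{R}^m$; (2) $T=\frac1{\sqrt k}U$ with the entries of $U$ independent and standard normal; (3) $T=\frac1{\sqrt k}U$ with the entries of $U$ independent and equal to $\pm1$ with probability $\frac12$ each; (4) $T=\sqrt{\frac3k}\,U$ with the entries of $U$ independent and equal to $+1,0,-1$ with probabilities $\frac16,\frac23,\frac16$. For an $m\times n$ real matrix $A$ with columns $A_1,\dots,A_n$, let $\mathrm{cone}(A)=\{\sum_j\lambda_jA_j : \lambda\ge 0\}$, for $x\in\mathrm{cone}(A)$ let $\|x\|_A=\min\{\sum_j\lambda_j : \lambda\ge0,\ x=\sum_j\lambda_jA_j\}$, and let $\mu_A=\max\{\|x\|_A : x\in\mathrm{cone}(A),\ \|x\|\le1\}$, where $\|\cdot\|$ is the Euclidean norm. **Theorem 3.4.** There is a universal constant $\mathcal C>0$ such that the following holds for all $m,n,k$. Let $A$ be an $m\times n$ real matrix and $b\in\mathbb{R}^m$, where $b$ and all columns of $A$ have unit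 Euclidean norm. Suppose $b\notin\mathrm{cone}(A)$, and let $\Delta\ge0$ satisfy $\Delta\le\min_{x\in\mathrm{cone}(A)}\|b-x\|$. Then for every $\varepsilon$ with $$0<\varepsilon<\frac{\Delta^2}{\mu_A^2+2\mu_A\sqrt{1-\Delta^2}+1}$$ and every $k\times m$ random projector $T$, $$\mathrm{Prob}\bigl(Tb\notin\mathrm{cone}(TA)\bigr)\ \ge\ 1-2(n+1)(n+2)\,e^{-\mathcal C(\varepsilon^2-\varepsilon^3)k}.$$ -/

import Mathlib

open MeasureTheory ProbabilityTheory
open scoped Matrix ENNReal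

namespace RandomProjection

noncomputable section

/-- The `j`-th column of `A`, as a vector of Euclidean space. -/
def column {m n : ℕ} (A : Matrix (Fin m) (Fin n) ℝ) (j : Fin n) : EuclideanSpace ℝ (Fin m) :=
  WithLp.toLp 2 (A.col j)

/-- The product `M y` of a matrix and a vector of Euclidean space. -/
def apply {k m : ℕ} (M : Matrix (Fin k) (Fin m) ℝ) (y : EuclideanSpace ℝ (Fin m)) :
    EuclideanSpace ℝ (Fin k) :=
  WithLp.toLp 2 (M *ᵥ WithLp.ofLp y)

/-- The convex cone spanned by the columns of `A` (it contains `0`, also if there are no columns). -/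
def cone {m n : ℕ} (A : Matrix (Fin m) (Fin n) ℝ) : PointedCone ℝ (EuclideanSpace ℝ (Fin m)) :=
  PointedCone.hull ℝ (Set.range (column A))

theorem mem_cone_iff {m n : ℕ} (A : Matrix (Fin m) (Fin n) ℝ) (x : EuclideanSpace ℝ (Fin m)) :
    x ∈ cone A ↔ ∃ c : Fin n → ℝ, (∀ j, 0 ≤ c j) ∧ x = ∑ j, c j • column A j := by
  unfold cone
  constructor
  · intro h
    obtain ⟨c, hc⟩ := (Submodule.mem_span_range_iff_exists_fun _).1 h
    exact ⟨fun j => (c j : ℝ), fun j => (c j).2, hc.symm⟩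
  · rintro ⟨c, hc, rfl⟩
    exact (Submodule.mem_span_range_iff_exists_fun _).2 ⟨fun j => ⟨c j, hc j⟩, rfl⟩

/-- The `A`-norm of `x ∈ cone A`: the least total weight of a representation of `x` as a
nonnegative combination of the columns of `A`. (For `x ∈ cone A` the set is nonempty, closed and
bounded below, so the infimum is a minimum; the value off the cone is never used.) -/
def aNorm {m n : ℕ} (A : Matrix (Fin m) (Fin n) ℝ) (x : EuclideanSpace ℝ (Fin m)) : ℝ :=
  sInf {s : ℝ | ∃ c : Fin n → ℝ,
    (∀ j, 0 ≤ c j) ∧ x = ∑ j, c j • column A j ∧ s = ∑ j, c j}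

/-- The distortion constant `μ_A`: the maximum of the `A`-norm over the part of the cone in the
Euclidean unit ball. (The `A`-norm is continuous on the cone, so the supremum is finite and
attained.) -/
def distortion {m n : ℕ} (A : Matrix (Fin m) (Fin n) ℝ) : ℝ :=
  sSup (aNorm A '' {x | x ∈ cone A ∧ ‖x‖ ≤ 1})

/-- The uniform distribution on `{1, -1}`. -/
def signLaw : Measure ℝ :=
  (1 / 2 : ℝ≥0∞) • Measure.dirac 1 + (1 / 2 : ℝ≥0∞) • Measure.dirac (-1)

/-- The distribution giving `1, 0, -1` the probabilities `1/6, 2/3, 1/6`. -/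
def sparseSignLaw : Measure ℝ :=
  (1 / 6 : ℝ≥0∞) • Measure.dirac 1 + (2 / 3 : ℝ≥0∞) • Measure.dirac 0
    + (1 / 6 : ℝ≥0∞) • Measure.dirac (-1)

/-- The entries of the random matrix `U` are independent, each with distribution `ν`. -/
structure HasIIDEntries {Ω : Type*} [MeasurableSpace Ω] {k m : ℕ} (P : Measure Ω) (ν : Measure ℝ)
    (U : Ω → Matrix (Fin k) (Fin m) ℝ) : Prop where
  hasLaw : ∀ i j, HasLaw (fun ω => U ω i j) ν P
  indep : iIndepFun (fun (p : Fin k × Fin m) (ω : Ω) => U ω p.1 p.2) P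

/-- `Q` is the `k × m` matrix of the orthogonal projection onto a uniformly random `k`-dimensional
subspace `V` of `ℝ^m`. The rows of `Q` are an orthonormal basis of `V`, so that `Q y` lists the
coordinates of the orthogonal projection of `y` to `V`, and `Qᵀ Q` is the `m × m` matrix of that
projection. Uniformity says that `V` and its image `R V` under any fixed orthogonal `R` have the same
distribution, where a subspace is identified with its projection matrix. How the orthonormal basis
of `V` is chosen is left free. -/
structure IsRandomOrthogonalProjection {Ω : Type*} [MeasurableSpace Ω] {k m : ℕ} (P : Measure Ω)
    (Q : Ω → Matrix (Fin k) (Fin m) ℝ) : Prop where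
  measurable : ∀ i j, AEMeasurable (fun ω => Q ω i j) P
  orthonormal_rows : ∀ᵐ ω ∂P, Q ω * (Q ω)ᵀ = 1
  rotation_invariant : ∀ R ∈ Matrix.orthogonalGroup (Fin m) ℝ,
    IdentDistrib (fun (ω : Ω) (i j : Fin m) => ((Q ω)ᵀ * Q ω) i j)
      (fun (ω : Ω) (i j : Fin m) => (R * ((Q ω)ᵀ * Q ω) * Rᵀ) i j) P P

/-- `k × m` random projectors, in each case normalised so that `‖T y‖²` has mean `‖y‖²`. -/
inductive IsRandomProjector {Ω : Type*} [MeasurableSpace Ω] {k m : ℕ} (P : Measure Ω) :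
    (Ω → Matrix (Fin k) (Fin m) ℝ) → Prop
  /-- Orthogonal projection on a random `k`-dimensional subspace. -/
  | orthogonal (Q : Ω → Matrix (Fin k) (Fin m) ℝ) (h : IsRandomOrthogonalProjection P Q) :
      IsRandomProjector P (fun ω => √((m : ℝ) / k) • Q ω)
  /-- Independent standard normal entries. -/
  | gaussian (U : Ω → Matrix (Fin k) (Fin m) ℝ) (h : HasIIDEntries P (gaussianReal 0 1) U) :
      IsRandomProjector P (fun ω => (1 / √(k : ℝ)) • U ω)
  /-- Independent uniform random signs. -/
  | sign (U : Ω → Matrix (Fin k) (Fin m) ℝ) (h : HasIIDEntries P signLaw U) :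
      IsRandomProjector P (fun ω => (1 / √(k : ℝ)) • U ω)
  /-- Independent entries `1, 0, -1` with probabilities `1/6, 2/3, 1/6` (of variance `1/3`). -/
  | sparseSign (U : Ω → Matrix (Fin k) (Fin m) ℝ) (h : HasIIDEntries P sparseSignLaw U) :
      IsRandomProjector P (fun ω => √(3 / (k : ℝ)) • U ω)

end

end RandomProjection

/-! Suppose Tb = Ty with y in the cone of A. If T changes every inner product among b and the
columns by at most ε, expanding ‖T(b-y)‖² gives an error of at most ε(1+∑d_j)² for every nonnegative
representation d of y (`abs_norm_sq_sub_le`), and d may have weight arbitrarily close to μ‖y‖, where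
μ is the distortion. Since T(b-y) = 0, this yields ‖b-y‖² ≤ ε(1+μ‖y‖)². But the distance Δ forces
⟨b,y⟩ ≤ √(1-Δ²)‖y‖, and the threshold on ε is the minimum of the resulting lower bound for
‖b-y‖²/(1+μ‖y‖)² (`mul_sq_lt_norm_sub_sq`). So `apply_notMem_cone` is deterministic.

It remains to preserve inner products with high probability. For independent entries and a unit
vector u, the coordinates of √k·Tu are independent standardized sub-Gaussian variables, and a
Chernoff bound controls their squares (`measureReal_abs_sum_sq_sub_card_le`). For a random
orthogonal projection, rotation invariance replaces u by an independent Gaussian vector; Fubini then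
allows Q to be frozen, which leads back to the Gaussian bound. Polarization passes from norms to
inner products, and a union bound runs over the (n+1)² pairs; its overly large prefactor is removed
by halving the exponent (`le_mul_exp_half`). -/

namespace RandomProjection

/-! ### Conic Carathéodory and finiteness of the distortion constant. -/

/-- The conic version of Carathéodory's theorem. -/
theorem exists_nonneg_linearIndepOn {ι E : Type*} [Fintype ι] [AddCommGroup E] [Module ℝ E]
    (a : ι → E) (c : ι → ℝ) (hc : ∀ j, 0 ≤ c j) :
    ∃ d : ι → ℝ, (∀ j, 0 ≤ d j) ∧ ∑ j, d j • a j = ∑ j, c j • a j ∧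
      LinearIndepOn ℝ a {j | d j ≠ 0} := by
  classical
  induction h : (Finset.univ.filter (fun j => c j ≠ 0)).card using Nat.strong_induction_on
    generalizing c with
  | _ N ih =>
  by_cases hli : LinearIndepOn ℝ a {j | c j ≠ 0}
  · exact ⟨c, hc, rfl, hli⟩
  have hset : {j | c j ≠ 0} = ((Finset.univ.filter (fun j => c j ≠ 0) : Finset ι) : Set ι) := by
    ext; simp
  rw [hset, linearIndepOn_finset_iff] at hli
  push Not at hli
  obtain ⟨g₀, hg₀, i₀, hi₀, hgi₀⟩ := hli
  obtain ⟨g, hg, i₁, hi₁, hgi₁⟩ : ∃ g : ι → ℝ, ∑ i ∈ Finset.univ.filter (fun j => c j ≠ 0), g i • a i = 0 ∧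
      ∃ i ∈ Finset.univ.filter (fun j => c j ≠ 0), 0 < g i := by
    rcases lt_or_gt_of_ne hgi₀ with h0 | h0
    · exact ⟨-g₀, by simp [hg₀], i₀, hi₀, by simpa using h0⟩
    · exact ⟨g₀, hg₀, i₀, hi₀, h0⟩
  -- Moving c along the relation g until the first coefficient vanishes: the minimal ratio keeps all
  -- coefficients nonnegative and kills index i, so the support shrinks.
  obtain ⟨i, hi, hmin⟩ := Finset.exists_min_image
    ((Finset.univ.filter (fun j => c j ≠ 0)).filter (fun j => 0 < g j)) (fun j => c j / g j)
    ⟨i₁, by simp only [Finset.mem_filter] at hi₁ ⊢; exact ⟨hi₁, hgi₁⟩⟩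
  simp only [Finset.mem_filter, Finset.mem_univ, true_and] at hi hmin
  let d : ι → ℝ := fun j => if c j ≠ 0 then c j - c i / g i * g j else 0
  have hd : ∀ j, 0 ≤ d j := by
    intro j
    by_cases hj : c j ≠ 0
    · simp only [d, if_pos hj, sub_nonneg]
      rcases le_or_gt (g j) 0 with hgj | hgj
      · exact (mul_nonpos_of_nonneg_of_nonpos (div_nonneg (hc i) hi.2.le) hgj).trans (hc j)
      · have := hmin j ⟨hj, hgj⟩
        rwa [le_div_iff₀ hgj] at this
    · simp only [d, if_neg hj, le_refl]
  have hdc : ∑ j, d j • a j = ∑ j, c j • a j := by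
    rw [← Finset.sum_filter_add_sum_filter_not Finset.univ (fun j => c j ≠ 0) (fun j => d j • a j),
      ← Finset.sum_filter_add_sum_filter_not Finset.univ (fun j => c j ≠ 0) (fun j => c j • a j)]
    congr 1
    · rw [← sub_eq_zero, ← Finset.sum_sub_distrib]
      have : ∀ j ∈ Finset.univ.filter (fun j => c j ≠ 0),
          d j • a j - c j • a j = (-(c i / g i)) • (g j • a j) := by
        intro j hj
        simp only [Finset.mem_filter, Finset.mem_univ, true_and] at hj
        simp only [d, if_pos hj, smul_smul, ← sub_smul]
        congr 1
        ring
      rw [Finset.sum_congr rfl this, ← Finset.smul_sum, hg, smul_zero]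
    · refine Finset.sum_congr rfl fun j hj => ?_
      simp only [Finset.mem_filter, Finset.mem_univ, true_and] at hj
      simp only [d, if_neg hj, not_not.1 hj]
  have hcard : (Finset.univ.filter (fun j => d j ≠ 0)).card < N := by
    rw [← h]
    refine Finset.card_lt_card ?_
    rw [Finset.ssubset_iff_of_subset]
    · refine ⟨i, by simpa using hi.1, ?_⟩
      have := hi.2.ne'
      simp [d, this]
    · intro j hj
      simp only [Finset.mem_filter, Finset.mem_univ, true_and] at hj ⊢
      intro h0
      exact hj (by simp [d, h0])
  obtain ⟨e, he, hed, hli'⟩ := ih _ hcard d hd rfl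
  exact ⟨e, he, hed.trans hdc, hli'⟩

/-- An injective linear map out of the finite-dimensional space ℝ^S is bounded below; passing from
the sup norm to the sum of absolute values costs a factor |S|. -/
theorem exists_sum_abs_le_of_linearIndepOn {ι E : Type*} [Fintype ι] [NormedAddCommGroup E]
    [NormedSpace ℝ E] (a : ι → E) (S : Set ι) (hS : LinearIndepOn ℝ a S) :
    ∃ M : ℝ, 0 ≤ M ∧ ∀ d : ι → ℝ, (∀ j ∉ S, d j = 0) → ∑ j, |d j| ≤ M * ‖∑ j, d j • a j‖ := by
  classical
  let f : (S → ℝ) →ₗ[ℝ] E := Fintype.linearCombination ℝ (fun j : S => a j)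
  have hf : LinearMap.ker f = ⊥ := by
    rw [LinearMap.ker_eq_bot]
    exact linearIndependent_iff_injective_fintypeLinearCombination.1 hS
  obtain ⟨K, -, hK⟩ := f.exists_antilipschitzWith hf
  refine ⟨Fintype.card S * K, by positivity, fun d hd => ?_⟩
  have hsum : ∑ j, d j • a j = f (fun j => d j) := by
    simp only [f, Fintype.linearCombination_apply]
    refine (Fintype.sum_of_injective Subtype.val Subtype.val_injective _ _ ?_ fun _ => rfl).symm
    intro j hj
    rw [hd j (by simpa using hj), zero_smul]
  have habs : ∑ j, |d j| = ∑ j : S, |d j| := by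
    refine (Fintype.sum_of_injective Subtype.val Subtype.val_injective _ _ ?_ fun _ => rfl).symm
    intro j hj
    rw [hd j (by simpa using hj), abs_zero]
  have hb : ‖(fun j : S => d j)‖ ≤ K * ‖f (fun j => d j)‖ := by
    simpa using hK.le_mul_norm_sub (x := fun j : S => d j) (y := 0)
  rw [hsum, habs, mul_assoc]
  calc ∑ j : S, |d j| ≤ ∑ j : S, ‖(fun j : S => d j)‖ :=
        Finset.sum_le_sum fun j _ => norm_le_pi_norm (fun j : S => d j) j
    _ = Fintype.card S * ‖(fun j : S => d j)‖ := by simp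
    _ ≤ _ := by gcongr

/-- Carathéodory reduces to independent supports, of which there are finitely many, so the sum of
their constants serves for all. -/
theorem exists_sum_le_mul_norm {ι E : Type*} [Fintype ι] [NormedAddCommGroup E]
    [NormedSpace ℝ E] (a : ι → E) :
    ∃ M : ℝ, ∀ c : ι → ℝ, (∀ j, 0 ≤ c j) → ∃ d : ι → ℝ, (∀ j, 0 ≤ d j) ∧
      ∑ j, d j • a j = ∑ j, c j • a j ∧ ∑ j, d j ≤ M * ‖∑ j, c j • a j‖ := by
  classical
  have hex : ∀ S : Set ι, ∃ M : ℝ, 0 ≤ M ∧ (LinearIndepOn ℝ a S →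
      ∀ d : ι → ℝ, (∀ j ∉ S, d j = 0) → ∑ j, |d j| ≤ M * ‖∑ j, d j • a j‖) := by
    intro S
    by_cases hS : LinearIndepOn ℝ a S
    · obtain ⟨M, hM, h⟩ := exists_sum_abs_le_of_linearIndepOn a S hS
      exact ⟨M, hM, fun _ => h⟩
    · exact ⟨0, le_rfl, fun h => absurd h hS⟩
  choose M hM h using hex
  refine ⟨∑ S, M S, fun c hc => ?_⟩
  obtain ⟨d, hd, hdc, hli⟩ := exists_nonneg_linearIndepOn a c hc
  refine ⟨d, hd, hdc, ?_⟩
  have h1 := h _ hli d (by simp)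
  rw [hdc] at h1
  calc ∑ j, d j = ∑ j, |d j| := by simp_rw [abs_of_nonneg (hd _)]
    _ ≤ _ := h1
    _ ≤ _ := by
      gcongr
      exact Finset.single_le_sum (fun S _ => hM S) (Finset.mem_univ _)

variable {m n : ℕ}

theorem aNorm_nonneg (A : Matrix (Fin m) (Fin n) ℝ) (x : EuclideanSpace ℝ (Fin m)) :
    0 ≤ aNorm A x := by
  refine Real.sInf_nonneg ?_
  rintro _ ⟨c, hc, -, rfl⟩
  exact Finset.sum_nonneg fun j _ => hc j

theorem aNorm_le (A : Matrix (Fin m) (Fin n) ℝ) {c : Fin n → ℝ} (hc : ∀ j, 0 ≤ c j) :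
    aNorm A (∑ j, c j • column A j) ≤ ∑ j, c j := by
  refine csInf_le ⟨0, ?_⟩ ⟨c, hc, rfl, rfl⟩
  rintro _ ⟨c, hc, -, rfl⟩
  exact Finset.sum_nonneg fun j _ => hc j

theorem distortion_nonneg (A : Matrix (Fin m) (Fin n) ℝ) : 0 ≤ distortion A := by
  refine Real.sSup_nonneg ?_
  rintro _ ⟨x, -, rfl⟩
  exact aNorm_nonneg A x

/-- Needed because `sSup` of an unbounded set of reals defaults to 0, and `distortion` would then
bound nothing. -/
theorem bddAbove_aNorm (A : Matrix (Fin m) (Fin n) ℝ) :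
    BddAbove (aNorm A '' {x | x ∈ cone A ∧ ‖x‖ ≤ 1}) := by
  obtain ⟨M, hM⟩ := exists_sum_le_mul_norm (column A)
  refine ⟨max M 0, ?_⟩
  rintro _ ⟨x, ⟨hx, hx1⟩, rfl⟩
  obtain ⟨c, hc, rfl⟩ := (mem_cone_iff A x).1 hx
  obtain ⟨d, hd, hdc, hle⟩ := hM c hc
  rw [← hdc] at hx1 hle ⊢
  refine (aNorm_le A hd).trans (hle.trans ?_)
  calc M * ‖∑ j, d j • column A j‖ ≤ max M 0 * ‖∑ j, d j • column A j‖ := by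
        gcongr; exact le_max_left _ _
    _ ≤ max M 0 * 1 := by gcongr
    _ = _ := mul_one _

theorem smul_mem_cone (A : Matrix (Fin m) (Fin n) ℝ) {x : EuclideanSpace ℝ (Fin m)}
    (hx : x ∈ cone A) {t : ℝ} (ht : 0 ≤ t) : t • x ∈ cone A :=
  (cone A).smul_mem ht hx

/-- Representations of a vector of the cone have total weight at most its norm times the
distortion, up to an arbitrarily small error. -/
theorem exists_sum_lt (A : Matrix (Fin m) (Fin n) ℝ) {x : EuclideanSpace ℝ (Fin m)}
    (hx : x ∈ cone A) {η : ℝ} (hη : 0 < η) :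
    ∃ c : Fin n → ℝ, (∀ j, 0 ≤ c j) ∧ x = ∑ j, c j • column A j ∧
      ∑ j, c j < distortion A * ‖x‖ + η := by
  rcases eq_or_ne x 0 with rfl | hx0
  · exact ⟨0, by simp, by simp, by simpa using hη⟩
  have hpos : 0 < ‖x‖ := norm_pos_iff.2 hx0
  have hy : ‖x‖⁻¹ • x ∈ cone A := smul_mem_cone A hx (by positivity)
  have hy1 : ‖‖x‖⁻¹ • x‖ ≤ 1 := by
    rw [norm_smul, norm_inv, norm_norm, inv_mul_cancel₀ hpos.ne']
  have hle : aNorm A (‖x‖⁻¹ • x) ≤ distortion A :=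
    le_csSup (bddAbove_aNorm A) ⟨_, ⟨hy, hy1⟩, rfl⟩
  have hlt : aNorm A (‖x‖⁻¹ • x) < distortion A + η / ‖x‖ := by
    have : 0 < η / ‖x‖ := by positivity
    linarith
  obtain ⟨c, hc, hcx⟩ := (mem_cone_iff A _).1 hy
  obtain ⟨_, ⟨d, hd, hdx, rfl⟩, hdlt⟩ := exists_lt_of_csInf_lt
    (⟨_, c, hc, hcx, rfl⟩ : Set.Nonempty {s : ℝ | ∃ c : Fin n → ℝ, (∀ j, 0 ≤ c j) ∧
      ‖x‖⁻¹ • x = ∑ j, c j • column A j ∧ s = ∑ j, c j}) hlt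
  refine ⟨fun j => ‖x‖ * d j, fun j => mul_nonneg hpos.le (hd j), ?_, ?_⟩
  · simp_rw [mul_smul, ← Finset.smul_sum, ← hdx, smul_smul, mul_inv_cancel₀ hpos.ne', one_smul]
  · rw [← Finset.mul_sum]
    calc ‖x‖ * ∑ j, d j < ‖x‖ * (distortion A + η / ‖x‖) := by gcongr
      _ = _ := by field_simp

/-! ### Deterministic separation from approximately preserved inner products. -/

theorem abs_norm_sq_sub_le {ι E F : Type*} [Fintype ι] [NormedAddCommGroup E]
    [InnerProductSpace ℝ E] [NormedAddCommGroup F] [InnerProductSpace ℝ F] (L : E →ₗ[ℝ] F)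
    (w : ι → E) {ε : ℝ} (h : ∀ p q, |inner ℝ (L (w p)) (L (w q)) - inner ℝ (w p) (w q)| ≤ ε)
    (c : ι → ℝ) :
    |‖L (∑ p, c p • w p)‖ ^ 2 - ‖∑ p, c p • w p‖ ^ 2| ≤ ε * (∑ p, |c p|) ^ 2 := by
  have : ‖L (∑ p, c p • w p)‖ ^ 2 - ‖∑ p, c p • w p‖ ^ 2 =
      ∑ p, ∑ q, c p * c q * (inner ℝ (L (w p)) (L (w q)) - inner ℝ (w p) (w q)) := by
    rw [← real_inner_self_eq_norm_sq, ← real_inner_self_eq_norm_sq, map_sum]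
    simp_rw [map_smul, sum_inner, inner_sum, real_inner_smul_left, real_inner_smul_right,
      ← Finset.sum_sub_distrib]
    refine Finset.sum_congr rfl fun p _ => Finset.sum_congr rfl fun q _ => by ring
  rw [this]
  calc _ ≤ ∑ p, ∑ q, |c p * c q * (inner ℝ (L (w p)) (L (w q)) - inner ℝ (w p) (w q))| :=
        (Finset.abs_sum_le_sum_abs _ _).trans
          (Finset.sum_le_sum fun p _ => Finset.abs_sum_le_sum_abs _ _)
    _ ≤ ∑ p, ∑ q, |c p| * |c q| * ε := by
        refine Finset.sum_le_sum fun p _ => Finset.sum_le_sum fun q _ => ?_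
        rw [abs_mul, abs_mul]
        gcongr
        exact h p q
    _ = _ := by
        rw [sq, Finset.sum_mul_sum, Finset.mul_sum]
        refine Finset.sum_congr rfl fun p _ => ?_
        rw [Finset.mul_sum]
        exact Finset.sum_congr rfl fun q _ => by ring

/-- When s = ⟨b,y⟩ > 0, the projection of b to the ray through y lies in the cone, at squared
distance 1 - s²/‖y‖² from b. -/
theorem inner_le_of_le_infDist (A : Matrix (Fin m) (Fin n) ℝ) {b y : EuclideanSpace ℝ (Fin m)}
    {Δ : ℝ} (hb : ‖b‖ = 1) (hΔ : 0 ≤ Δ) (hd : Δ ≤ Metric.infDist b (cone A)) (hy : y ∈ cone A) :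
    inner ℝ b y ≤ √(1 - Δ ^ 2) * ‖y‖ := by
  rcases le_or_gt (inner ℝ b y) 0 with h0 | h0
  · exact h0.trans (by positivity)
  have hy0 : 0 < ‖y‖ := by
    rw [norm_pos_iff]
    rintro rfl
    simp at h0
  set s := inner ℝ b y with hs
  have hmem := smul_mem_cone A hy (t := s / ‖y‖ ^ 2) (by positivity)
  have h1 : Δ ≤ ‖b - (s / ‖y‖ ^ 2) • y‖ := by
    rw [← dist_eq_norm]
    exact hd.trans (Metric.infDist_le_dist_of_mem hmem)
  have h2 : Δ ^ 2 ≤ ‖b - (s / ‖y‖ ^ 2) • y‖ ^ 2 := by gcongr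
  rw [norm_sub_sq_real, real_inner_smul_right, hb, norm_smul, ← hs, mul_pow, Real.norm_eq_abs,
    sq_abs] at h2
  have h3 : s ^ 2 ≤ (1 - Δ ^ 2) * ‖y‖ ^ 2 := by
    have : Δ ^ 2 ≤ 1 - s ^ 2 / ‖y‖ ^ 2 := by
      refine h2.trans (le_of_eq ?_)
      field_simp
      ring
    rw [le_sub_comm, div_le_iff₀ (by positivity)] at this
    exact this
  have h4 : 0 ≤ 1 - Δ ^ 2 := by
    by_contra h
    have : (1 - Δ ^ 2) * ‖y‖ ^ 2 < 0 := mul_neg_of_neg_of_pos (by linarith) (by positivity)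
    nlinarith [sq_nonneg s]
  calc s = √(s ^ 2) := (Real.sqrt_sq h0.le).symm
    _ ≤ √((1 - Δ ^ 2) * ‖y‖ ^ 2) := Real.sqrt_le_sqrt h3
    _ = _ := by rw [Real.sqrt_mul h4, Real.sqrt_sq hy0.le]

theorem dist_le_one (A : Matrix (Fin m) (Fin n) ℝ) {b : EuclideanSpace ℝ (Fin m)}
    {Δ : ℝ} (hb : ‖b‖ = 1) (hd : Δ ≤ Metric.infDist b (cone A)) : Δ ≤ 1 := by
  refine hd.trans ((Metric.infDist_le_dist_of_mem (cone A).zero_mem).trans ?_)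
  rw [dist_zero_right, hb]

theorem mul_sq_lt_norm_sub_sq (A : Matrix (Fin m) (Fin n) ℝ) {b y : EuclideanSpace ℝ (Fin m)}
    {Δ ε : ℝ} (hb : ‖b‖ = 1) (hΔ : 0 ≤ Δ) (hd : Δ ≤ Metric.infDist b (cone A))
    (hε' : ε < Δ ^ 2 / (distortion A ^ 2 + 2 * distortion A * √(1 - Δ ^ 2) + 1))
    (hy : y ∈ cone A) :
    ε * (1 + distortion A * ‖y‖) ^ 2 < ‖b - y‖ ^ 2 := by
  have hΔ1 := dist_le_one A hb hd
  have hμ := distortion_nonneg A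
  set μ := distortion A
  have hh : √(1 - Δ ^ 2) ^ 2 = 1 - Δ ^ 2 := Real.sq_sqrt (by nlinarith)
  have hh0 := Real.sqrt_nonneg (1 - Δ ^ 2)
  set h := √(1 - Δ ^ 2) with hdef
  have hin : inner ℝ b y ≤ h * ‖y‖ := inner_le_of_le_infDist A hb hΔ hd hy
  have hnorm : 1 - 2 * h * ‖y‖ + ‖y‖ ^ 2 ≤ ‖b - y‖ ^ 2 := by
    rw [norm_sub_sq_real, hb]
    linarith
  have hy0 := norm_nonneg y
  set α := ‖y‖
  have hpos : 0 < μ ^ 2 + 2 * μ * h + 1 := by positivity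
  rw [lt_div_iff₀ hpos] at hε'
  have h1 : 0 < (1 + μ * α) ^ 2 := by positivity
  have key : Δ ^ 2 * (1 + μ * α) ^ 2 ≤
      (1 - 2 * h * α + α ^ 2) * (μ ^ 2 + 2 * μ * h + 1) := by
    have : Δ ^ 2 = 1 - h ^ 2 := by linarith
    rw [this]
    -- The right side minus the left is exactly (μ+h-α(1+hμ))²; equality at α = (μ+h)/(1+hμ) is what
    -- makes the threshold on ε optimal for this argument.
    nlinarith [sq_nonneg (μ + h - α * (1 + h * μ)), sq_nonneg (α - μ - h - μ * h * α)]
  refine lt_of_lt_of_le ?_ hnorm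
  refine lt_of_mul_lt_mul_right ?_ hpos.le
  nlinarith

/-- The product with a matrix, as a linear map. -/
noncomputable def applyₗ {k m : ℕ} (M : Matrix (Fin k) (Fin m) ℝ) :
    EuclideanSpace ℝ (Fin m) →ₗ[ℝ] EuclideanSpace ℝ (Fin k) where
  toFun := apply M
  map_add' x y := by simp [apply, Matrix.mulVec_add]
  map_smul' c x := by simp [apply, Matrix.mulVec_smul]

theorem applyₗ_apply {k m : ℕ} (M : Matrix (Fin k) (Fin m) ℝ) (x : EuclideanSpace ℝ (Fin m)) :
    applyₗ M x = apply M x := rfl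

theorem apply_column {k : ℕ} (M : Matrix (Fin k) (Fin m) ℝ) (A : Matrix (Fin m) (Fin n) ℝ)
    (j : Fin n) : column (M * A) j = applyₗ M (column A j) := by
  ext i
  simp [column, applyₗ_apply, apply, Matrix.mul_apply, Matrix.mulVec, dotProduct]

/-- A matrix that nearly preserves the inner products of `b` and the columns of `A` keeps `b`
separated from the cone. -/
theorem apply_notMem_cone {k : ℕ} (A : Matrix (Fin m) (Fin n) ℝ)
    {b : EuclideanSpace ℝ (Fin m)} {Δ ε : ℝ} (hb : ‖b‖ = 1) (hΔ : 0 ≤ Δ)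
    (hd : Δ ≤ Metric.infDist b (cone A))
    (hε' : ε < Δ ^ 2 / (distortion A ^ 2 + 2 * distortion A * √(1 - Δ ^ 2) + 1))
    (M : Matrix (Fin k) (Fin m) ℝ)
    (hM : ∀ p q : Option (Fin n), |inner ℝ (applyₗ M (p.elim b (column A)))
      (applyₗ M (q.elim b (column A))) - inner ℝ (p.elim b (column A)) (q.elim b (column A))| ≤ ε) :
    apply M b ∉ cone (M * A) := by
  intro hmem
  obtain ⟨c, hc, hbc⟩ := (mem_cone_iff _ _).1 hmem
  have hε : 0 ≤ ε := (abs_nonneg _).trans (hM none none)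
  set y := ∑ j, c j • column A j with hy
  have hycone : y ∈ cone A := (mem_cone_iff _ _).2 ⟨c, hc, rfl⟩
  have hLy : applyₗ M (b - y) = 0 := by
    have : applyₗ M b = applyₗ M y := by
      rw [hy, map_sum]
      simp_rw [map_smul, ← apply_column]
      exact hbc
    rw [map_sub, this, sub_self]
  -- The weight of c is uncontrolled, so c is replaced by a nearly optimal representation d of the
  -- same y. The slack η avoids proving that the infimum is attained.
  have hle : ∀ η : ℝ, 0 < η → ‖b - y‖ ^ 2 ≤ ε * (1 + distortion A * ‖y‖ + η) ^ 2 := by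
    intro η hη
    obtain ⟨d, hdpos, hdy, hsum⟩ := exists_sum_lt A hycone hη
    have := abs_norm_sq_sub_le (applyₗ M) (fun p : Option (Fin n) => p.elim b (column A)) hM
      (fun p => p.elim 1 (fun j => - d j))
    simp only [Fintype.sum_option, Option.elim, one_smul, neg_smul, Finset.sum_neg_distrib,
      ← hdy, ← sub_eq_add_neg, hLy, abs_one, abs_neg, abs_of_nonneg (hdpos _)] at this
    rw [norm_zero, zero_pow two_ne_zero, zero_sub, abs_neg, abs_of_nonneg (by positivity)] at this
    refine this.trans ?_
    have : 0 ≤ ∑ j, d j := Finset.sum_nonneg fun j _ => hdpos j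
    gcongr ε * ?_ ^ 2
    linarith
  have hlim : Filter.Tendsto (fun η : ℝ => ε * (1 + distortion A * ‖y‖ + η) ^ 2)
      (nhdsWithin 0 (Set.Ioi 0)) (nhds (ε * (1 + distortion A * ‖y‖ + 0) ^ 2)) :=
    (Continuous.tendsto (by fun_prop) 0).mono_left nhdsWithin_le_nhds
  have := ge_of_tendsto hlim (Filter.eventually_of_mem self_mem_nhdsWithin hle)
  rw [add_zero] at this
  exact absurd (mul_sq_lt_norm_sub_sq A hb hΔ hd hε' hycone) (not_lt.2 this)

/-! ### Chernoff bound for sums of squares of sub-Gaussian variables. -/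

section Chernoff

theorem lintegral_exp_sq_div_four_gaussianReal_le :
    ∫⁻ g, ENNReal.ofReal (Real.exp (g ^ 2 / 4)) ∂(gaussianReal 0 1) ≤ 2 := by
  rw [gaussianReal_of_var_ne_zero _ one_ne_zero,
    lintegral_withDensity_eq_lintegral_mul _ (measurable_gaussianPDF _ _) (by fun_prop)]
  have hpt : ∀ g : ℝ, (gaussianPDF 0 1 * fun g => ENNReal.ofReal (Real.exp (g ^ 2 / 4))) g =
      ENNReal.ofReal ((√(2 * Real.pi))⁻¹ * Real.exp (-(1 / 4) * g ^ 2)) := by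
    intro g
    rw [Pi.mul_apply, gaussianPDF, ← ENNReal.ofReal_mul (gaussianPDFReal_nonneg _ _ _),
      gaussianPDFReal, mul_assoc, ← Real.exp_add]
    congr 2
    · simp
    · congr 1
      simp
      ring
  simp_rw [hpt]
  rw [← ofReal_integral_eq_lintegral_ofReal
    ((integrable_exp_neg_mul_sq (by norm_num)).const_mul _)
    (Filter.Eventually.of_forall fun g => by positivity), integral_const_mul, integral_gaussian]
  have h : (√(2 * Real.pi))⁻¹ * √(Real.pi / (1 / 4)) ≤ 2 := by
    rw [inv_mul_le_iff₀ (by positivity)]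
    rw [Real.sqrt_le_left (by positivity), mul_pow, Real.sq_sqrt (by positivity)]
    nlinarith [Real.pi_pos]
  exact (ENNReal.ofReal_le_ofReal h).trans (by simp)

theorem lintegral_exp_mul_gaussianReal (x : ℝ) :
    ∫⁻ g, ENNReal.ofReal (Real.exp (x * g)) ∂(gaussianReal 0 1) =
      ENNReal.ofReal (Real.exp (x ^ 2 / 2)) := by
  rw [← ofReal_integral_eq_lintegral_ofReal (integrable_exp_mul_gaussianReal x)
    (Filter.Eventually.of_forall fun g => by positivity)]
  congr 1
  have := congrFun (mgf_id_gaussianReal (μ := 0) (v := 1)) x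
  simpa [mgf] using this

variable {Ω : Type*} [MeasurableSpace Ω] {P : Measure Ω} [IsProbabilityMeasure P] {X : Ω → ℝ}

/-- Linearize the square with an auxiliary Gaussian: exp(X²/12) = E_g exp(tXg) for t² = 1/6. After
Tonelli, the sub-Gaussian bound in X leaves E exp(g²/4) = √2. -/
theorem lintegral_exp_sq_le (hX : HasSubgaussianMGF X 3 P) :
    ∫⁻ ω, ENNReal.ofReal (Real.exp (X ω ^ 2 / 12)) ∂P ≤ 2 := by
  set t : ℝ := (√6)⁻¹ with ht
  have ht2 : t ^ 2 = 1 / 6 := by rw [ht, inv_pow, Real.sq_sqrt (by norm_num)]; norm_num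
  have hm := hX.aemeasurable
  calc ∫⁻ ω, ENNReal.ofReal (Real.exp (X ω ^ 2 / 12)) ∂P
      = ∫⁻ ω, ∫⁻ g, ENNReal.ofReal (Real.exp (t * X ω * g)) ∂(gaussianReal 0 1) ∂P := by
        refine lintegral_congr fun ω => ?_
        rw [lintegral_exp_mul_gaussianReal, mul_pow, ht2]
        congr 2
        ring
    _ = ∫⁻ g, ∫⁻ ω, ENNReal.ofReal (Real.exp (t * X ω * g)) ∂P ∂(gaussianReal 0 1) := by
        refine lintegral_lintegral_swap ?_
        have : AEMeasurable (fun p : Ω × ℝ => X p.1) (P.prod (gaussianReal 0 1)) := hm.comp_fst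
        simp only [Function.uncurry_def]
        fun_prop
    _ ≤ ∫⁻ g, ENNReal.ofReal (Real.exp (g ^ 2 / 4)) ∂(gaussianReal 0 1) := by
        refine lintegral_mono fun g => ?_
        have h1 := hX.integrable_exp_mul (t * g)
        have h2 := hX.mgf_le (t * g)
        simp_rw [show ∀ ω, t * X ω * g = t * g * X ω from fun ω => by ring]
        rw [← ofReal_integral_eq_lintegral_ofReal h1
          (Filter.Eventually.of_forall fun g => by positivity)]
        refine ENNReal.ofReal_le_ofReal (h2.trans (le_of_eq ?_))
        rw [mul_pow, ht2]
        congr 1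
        push_cast
        ring
    _ ≤ 2 := lintegral_exp_sq_div_four_gaussianReal_le

theorem integrable_exp_sq (hX : HasSubgaussianMGF X 3 P) :
    Integrable (fun ω => Real.exp (X ω ^ 2 / 12)) P := by
  have hm := hX.aemeasurable
  refine ⟨AEMeasurable.aestronglyMeasurable (by fun_prop), ?_⟩
  rw [hasFiniteIntegral_iff_ofReal (Filter.Eventually.of_forall fun g => by positivity)]
  exact (lintegral_exp_sq_le hX).trans_lt (by simp)

theorem integral_exp_sq_le (hX : HasSubgaussianMGF X 3 P) :
    ∫ ω, Real.exp (X ω ^ 2 / 12) ∂P ≤ 2 := by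
  rw [integral_eq_lintegral_of_nonneg_ae (Filter.Eventually.of_forall fun g => by positivity)
    (integrable_exp_sq hX).1]
  exact ENNReal.toReal_le_of_le_ofReal (by norm_num) (by simpa using lintegral_exp_sq_le hX)

theorem exp_le_one_add_add_sq_mul_exp_abs (x : ℝ) :
    Real.exp x ≤ 1 + x + x ^ 2 * Real.exp |x| := by
  have h := Complex.norm_exp_sub_sum_le_norm_mul_exp (x : ℂ) 2
  have h2 : Complex.exp x - ∑ m ∈ Finset.range 2, (x : ℂ) ^ m / m.factorial =
      ((Real.exp x - (1 + x) : ℝ) : ℂ) := by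
    simp [Finset.sum_range_succ]
  rw [h2, Complex.norm_real, Complex.norm_real, Real.norm_eq_abs, Real.norm_eq_abs, sq_abs] at h
  linarith [le_abs_self (Real.exp x - (1 + x))]

/-- Second-order Taylor bound. With y = |x²-1|, both y² ≤ 1152·exp(y/24) and exp(|s|y) ≤ exp(y/24)
are absorbed into exp(y/12) ≤ (5/4)·exp(x²/12), and 1152·5/4 = 1440 ≤ 1500. -/
theorem exp_mul_sq_sub_one_le {s : ℝ} (hs : |s| ≤ 1 / 24) (x : ℝ) :
    Real.exp (s * (x ^ 2 - 1)) ≤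
      1 + s * (x ^ 2 - 1) + 1500 * s ^ 2 * Real.exp (x ^ 2 / 12) := by
  refine (exp_le_one_add_add_sq_mul_exp_abs _).trans ?_
  have hY : |x ^ 2 - 1| ≤ x ^ 2 + 1 := by
    rw [abs_le]; constructor <;> nlinarith [sq_nonneg x]
  have h0 := abs_nonneg (x ^ 2 - 1)
  have hsq : (x ^ 2 - 1) ^ 2 ≤ 1152 * Real.exp (|x ^ 2 - 1| / 24) := by
    have := Real.quadratic_le_exp_of_nonneg (x := |x ^ 2 - 1| / 24) (by positivity)
    rw [div_pow, sq_abs] at this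
    linarith
  have hexp : Real.exp (1 / 12) ≤ 5 / 4 := by
    have := Real.exp_bound_div_one_sub_of_interval (x := 1 / 12) (by norm_num) (by norm_num)
    refine this.trans (by norm_num)
  have habs : |s * (x ^ 2 - 1)| ≤ |x ^ 2 - 1| / 24 := by
    rw [abs_mul]
    calc |s| * |x ^ 2 - 1| ≤ 1 / 24 * |x ^ 2 - 1| := by gcongr
      _ = _ := by ring
  have : (s * (x ^ 2 - 1)) ^ 2 * Real.exp |s * (x ^ 2 - 1)| ≤
      1500 * s ^ 2 * Real.exp (x ^ 2 / 12) := by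
    calc (s * (x ^ 2 - 1)) ^ 2 * Real.exp |s * (x ^ 2 - 1)|
        ≤ s ^ 2 * (1152 * Real.exp (|x ^ 2 - 1| / 24)) * Real.exp (|x ^ 2 - 1| / 24) := by
          rw [mul_pow]; gcongr
      _ = s ^ 2 * 1152 * Real.exp (|x ^ 2 - 1| / 12) := by
          rw [mul_assoc, mul_assoc, ← Real.exp_add, ← mul_assoc]
          congr 2
          ring
      _ ≤ s ^ 2 * 1152 * Real.exp (1 / 12 + x ^ 2 / 12) := by
          gcongr
          linarith
      _ ≤ s ^ 2 * 1152 * (5 / 4 * Real.exp (x ^ 2 / 12)) := by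
          rw [Real.exp_add]
          gcongr
      _ ≤ _ := by
          nlinarith [mul_nonneg (sq_nonneg s) (Real.exp_pos (x ^ 2 / 12)).le]
  linarith

theorem integrable_exp_mul_sq_sub_one (hX : HasSubgaussianMGF X 3 P) {s : ℝ}
    (hs : |s| ≤ 1 / 24) : Integrable (fun ω => Real.exp (s * (X ω ^ 2 - 1))) P := by
  have hm := hX.aemeasurable
  have hsq : Integrable (fun ω => X ω ^ 2) P := (hX.memLp 2).integrable_sq
  refine Integrable.mono' ((((integrable_const 1).add
    ((hsq.sub (integrable_const 1)).const_mul s)).add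
      ((integrable_exp_sq hX).const_mul (1500 * s ^ 2))))
    (AEMeasurable.aestronglyMeasurable (by fun_prop)) (Filter.Eventually.of_forall fun ω => ?_)
  rw [Real.norm_eq_abs, abs_of_pos (Real.exp_pos _)]
  exact exp_mul_sq_sub_one_le hs (X ω)

/-- Unit second moment removes the linear term of the pointwise bound, leaving only an error
quadratic in s. -/
theorem mgf_sq_sub_one_le (hX : HasSubgaussianMGF X 3 P) (h1 : ∫ ω, X ω ^ 2 ∂P = 1) {s : ℝ}
    (hs : |s| ≤ 1 / 24) : mgf (fun ω => X ω ^ 2 - 1) P s ≤ Real.exp (3000 * s ^ 2) := by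
  have hsq : Integrable (fun ω => X ω ^ 2) P := (hX.memLp 2).integrable_sq
  have hi1 : Integrable (fun ω => s * (X ω ^ 2 - 1)) P :=
    (hsq.sub (integrable_const 1)).const_mul s
  have hi2 := (integrable_exp_sq hX).const_mul (1500 * s ^ 2)
  calc mgf (fun ω => X ω ^ 2 - 1) P s
      ≤ ∫ ω, (1 + s * (X ω ^ 2 - 1) + 1500 * s ^ 2 * Real.exp (X ω ^ 2 / 12)) ∂P :=
        integral_mono (integrable_exp_mul_sq_sub_one hX hs)
          (((integrable_const 1).add hi1).add hi2) fun ω => exp_mul_sq_sub_one_le hs (X ω)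
    _ = 1 + 1500 * s ^ 2 * ∫ ω, Real.exp (X ω ^ 2 / 12) ∂P := by
        have hi0 : Integrable (fun ω => 1 + s * (X ω ^ 2 - 1)) P := (integrable_const 1).add hi1
        rw [integral_add hi0 hi2, integral_add (integrable_const 1) hi1,
          integral_const_mul, integral_const_mul, integral_sub hsq (integrable_const 1), h1]
        simp
    _ ≤ 1 + 3000 * s ^ 2 := by
        nlinarith [mul_le_mul_of_nonneg_left (integral_exp_sq_le hX) (sq_nonneg s)]
    _ ≤ _ := by linarith [Real.add_one_le_exp (3000 * s ^ 2)]

/-- Concentration of the sum of squares of independent standardized sub-Gaussian variables. -/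
theorem measureReal_abs_sum_sq_sub_card_le {ι : Type*} [Fintype ι] {X : ι → Ω → ℝ}
    (hind : iIndepFun X P) (hX : ∀ i, HasSubgaussianMGF (X i) 3 P)
    (h1 : ∀ i, ∫ ω, X i ω ^ 2 ∂P = 1) {ε : ℝ} (hε : 0 ≤ ε) (hε1 : ε ≤ 1) :
    P.real {ω | ε * Fintype.card ι ≤ |∑ i, X i ω ^ 2 - Fintype.card ι|} ≤
      2 * Real.exp (-(ε ^ 2 * Fintype.card ι / 12000)) := by
  set Y : ι → Ω → ℝ := fun i ω => X i ω ^ 2 - 1 with hY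
  have hmY : ∀ i, AEMeasurable (Y i) P := fun i => by
    have := (hX i).aemeasurable
    fun_prop
  have hindY : iIndepFun Y P := hind.comp (fun _ x => x ^ 2 - 1) (fun _ => by fun_prop)
  have hsum : ∀ ω, (∑ i, Y i) ω = ∑ i, X i ω ^ 2 - Fintype.card ι := by
    intro ω
    simp [Y, Finset.sum_sub_distrib]
  have hmgf : ∀ s : ℝ, |s| ≤ 1 / 24 →
      mgf (∑ i, Y i) P s ≤ Real.exp (3000 * s ^ 2 * Fintype.card ι) := by
    intro s hs
    rw [hindY.mgf_sum₀ hmY]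
    calc ∏ i, mgf (Y i) P s ≤ ∏ _i : ι, Real.exp (3000 * s ^ 2) :=
          Finset.prod_le_prod (fun i _ => mgf_nonneg) fun i _ => mgf_sq_sub_one_le (hX i) (h1 i) hs
      _ = _ := by
          rw [Finset.prod_const, ← Real.exp_nat_mul, mul_comm]
          simp
  have hint : ∀ s : ℝ, |s| ≤ 1 / 24 → Integrable (fun ω => Real.exp (s * (∑ i, Y i) ω)) P :=
    fun s hs => by
      -- A nonintegrable exponential has `mgf` zero by default, so positivity of the product of the
      -- factors' `mgf` gives integrability.
      rw [← mgf_pos_iff, hindY.mgf_sum₀ hmY]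
      exact Finset.prod_pos fun i _ => mgf_pos (integrable_exp_mul_sq_sub_one (hX i) hs)
  -- s = ε/6000 minimizes 3000s² - εs, with value -ε²/12000.
  have hs : |ε / 6000| ≤ 1 / 24 := by rw [abs_of_nonneg (by positivity)]; linarith
  have hs' : |-(ε / 6000)| ≤ 1 / 24 := by rwa [abs_neg]
  have hup := measure_ge_le_exp_mul_mgf (ε * Fintype.card ι) (by positivity) (hint _ hs)
  have hlo := measure_le_le_exp_mul_mgf (-(ε * Fintype.card ι))
    (neg_nonpos.2 (by positivity)) (hint _ hs')
  have hup' := hup.trans (mul_le_mul_of_nonneg_left (hmgf _ hs) (Real.exp_nonneg _))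
  have hlo' := hlo.trans (mul_le_mul_of_nonneg_left (hmgf _ hs') (Real.exp_nonneg _))
  rw [← Real.exp_add] at hup' hlo'
  have hsub : {ω | ε * Fintype.card ι ≤ |∑ i, X i ω ^ 2 - Fintype.card ι|} ⊆
      {ω | ε * Fintype.card ι ≤ (∑ i, Y i) ω} ∪ {ω | (∑ i, Y i) ω ≤ -(ε * Fintype.card ι)} := by
    intro ω hω
    simp only [Set.mem_ofPred_eq, Set.mem_union, hsum] at hω ⊢
    rcases le_abs'.1 hω with h | h
    · exact Or.inr h
    · exact Or.inl h
  refine (measureReal_mono hsub).trans ((measureReal_union_le _ _).trans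
    ((add_le_add hup' hlo').trans (le_of_eq ?_)))
  rw [two_mul]
  congr 2 <;> ring

end Chernoff

/-! ### Matrices with independent entries. -/

section Entries

theorem hasSubgaussianMGF_mono {Ω : Type*} [MeasurableSpace Ω] {P : Measure Ω} {X : Ω → ℝ}
    {c d : NNReal} (h : HasSubgaussianMGF X c P) (hcd : c ≤ d) : HasSubgaussianMGF X d P where
  integrable_exp_mul := h.integrable_exp_mul
  mgf_le t := (h.mgf_le t).trans (by gcongr)

theorem hasSubgaussianMGF_const_mul {Ω : Type*} [MeasurableSpace Ω] {P : Measure Ω} {X : Ω → ℝ}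
    {c : NNReal} (h : HasSubgaussianMGF X c P) (r : ℝ) :
    HasSubgaussianMGF (fun ω => r * X ω) (Real.toNNReal (r ^ 2) * c) P := by
  rw [Real.toNNReal_of_nonneg (sq_nonneg r)]
  exact h.const_mul r

theorem HasIIDEntries.const_smul {Ω : Type*} [MeasurableSpace Ω] {P : Measure Ω} {k m : ℕ}
    {ν : Measure ℝ} {U : Ω → Matrix (Fin k) (Fin m) ℝ}
    (h : HasIIDEntries P ν U) (r : ℝ) : HasIIDEntries P (ν.map (r * ·)) (fun ω => r • U ω) where
  hasLaw i j := HasLaw.comp (Y := fun x => r * x) ⟨(measurable_const_mul r).aemeasurable, rfl⟩ (h.hasLaw i j)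
  indep := h.indep.comp (fun _ x => r * x) (fun _ => by fun_prop)

variable {Ω : Type*} [MeasurableSpace Ω] {P : Measure Ω} [IsProbabilityMeasure P] {k m : ℕ}
  {ν : Measure ℝ}

/-- The rows of a matrix with independent identically distributed entries are independent. -/
theorem HasIIDEntries.iIndepFun_rows [IsProbabilityMeasure ν] {U : Ω → Matrix (Fin k) (Fin m) ℝ}
    (h : HasIIDEntries P ν U) : iIndepFun (fun i ω j => U ω i j) P := by
  have hrow : ∀ i, HasLaw (fun ω j => U ω i j) (Measure.pi fun _ : Fin m => ν) P := fun i =>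
    iIndepFun.hasLaw_pi (fun j => h.hasLaw i j)
      (h.indep.precomp (g := fun j => (i, j)) fun j j' hj => (Prod.mk.inj hj).2)
  rw [iIndepFun_iff_hasLaw_pi_pi hrow]
  have hall : HasLaw (fun ω (p : Fin k × Fin m) => U ω p.1 p.2) (Measure.pi fun _ => ν) P :=
    iIndepFun.hasLaw_pi (fun p => h.hasLaw p.1 p.2) h.indep
  have hcurry : HasLaw (MeasurableEquiv.curry (Fin k) (Fin m) ℝ)
      (Measure.pi fun _ => Measure.pi fun _ => ν) (Measure.pi fun _ => ν) := by
    refine ⟨(MeasurableEquiv.measurable _).aemeasurable, ?_⟩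
    have := Measure.infinitePi_map_curry (fun (_ : Fin k) (_ : Fin m) => ν)
    simpa only [Measure.infinitePi_eq_pi] using this
  exact hcurry.comp hall

/-- Concentration of the norm for matrices with independent standardized sub-Gaussian entries. -/
theorem HasIIDEntries.measureReal_le [IsProbabilityMeasure ν] {U : Ω → Matrix (Fin k) (Fin m) ℝ}
    (h : HasIIDEntries P ν U) (hsub : HasSubgaussianMGF id 3 ν) (hmean : ∫ x, x ∂ν = 0)
    (hvar : ∫ x, x ^ 2 ∂ν = 1) {y : Fin m → ℝ} (hy : ∑ j, y j ^ 2 = 1) {ε : ℝ} (hε : 0 ≤ ε)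
    (hε1 : ε ≤ 1) :
    P.real {ω | ε * k ≤ |∑ i, (∑ j, U ω i j * y j) ^ 2 - k|} ≤
      2 * Real.exp (-(ε ^ 2 * k / 12000)) := by
  have hUsub : ∀ i j, HasSubgaussianMGF (fun ω => U ω i j) 3 P := fun i j =>
    HasSubgaussianMGF.of_map (X := id) (h.hasLaw i j).aemeasurable (by rwa [(h.hasLaw i j).map_eq])
  have hrowind : ∀ i, iIndepFun (fun j ω => U ω i j) P := fun i =>
    h.indep.precomp (g := fun j => (i, j)) fun j j' hj => (Prod.mk.inj hj).2
  have hterm : ∀ i, iIndepFun (fun j ω => y j * U ω i j) P := fun i =>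
    (hrowind i).comp (fun j x => y j * x) (fun _ => by fun_prop)
  have hind : iIndepFun (fun i ω => ∑ j, y j * U ω i j) P :=
    h.iIndepFun_rows.comp (fun _ x => ∑ j, y j * x j) (fun _ => by fun_prop)
  have hX : ∀ i, HasSubgaussianMGF (fun ω => ∑ j, y j * U ω i j) 3 P := by
    intro i
    have := HasSubgaussianMGF.sum_of_iIndepFun (hterm i) (s := Finset.univ)
      (fun j _ => hasSubgaussianMGF_const_mul (hUsub i j) (y j))
    refine hasSubgaussianMGF_mono this (le_of_eq ?_)
    -- The variance proxies 3·y_j² of the terms add up to 3, as y is a unit vector.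
    rw [← Finset.sum_mul, ← Real.toNNReal_sum_of_nonneg fun j _ => sq_nonneg (y j), hy]
    simp
  have hL2 : ∀ i j, MemLp (fun ω => y j * U ω i j) 2 P := fun i j =>
    ((hUsub i j).memLp 2).const_mul (y j)
  have hEU : ∀ i j, ∫ ω, U ω i j ∂P = 0 := fun i j => by rw [(h.hasLaw i j).integral_eq, hmean]
  have hE : ∀ i, ∫ ω, ∑ j, y j * U ω i j ∂P = 0 := by
    intro i
    rw [integral_finsetSum _ fun j _ => (hL2 i j).integrable (by norm_num)]
    simp [integral_const_mul, hEU]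
  have hVU : ∀ i j, Var[fun ω => U ω i j; P] = 1 := by
    intro i j
    rw [variance_of_integral_eq_zero (h.hasLaw i j).aemeasurable (hEU i j), ← hvar]
    exact (h.hasLaw i j).integral_comp (f := fun x => x ^ 2)
      (AEMeasurable.aestronglyMeasurable (by fun_prop))
  have h1 : ∀ i, ∫ ω, (∑ j, y j * U ω i j) ^ 2 ∂P = 1 := by
    intro i
    rw [← variance_of_integral_eq_zero (hX i).aemeasurable (hE i)]
    have := IndepFun.variance_sum (X := fun j ω => y j * U ω i j) (μ := P) (s := Finset.univ)
      (fun j _ => hL2 i j) (fun j _ j' _ hj => (hterm i).indepFun hj)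
    rw [show (fun ω => ∑ j, y j * U ω i j) = ∑ j, fun ω => y j * U ω i j by ext; simp, this]
    simp_rw [variance_const_mul, hVU, mul_one, hy]
  have := measureReal_abs_sum_sq_sub_card_le hind hX h1 hε hε1
  simpa only [Fintype.card_fin, mul_comm (y _)] using this

instance : IsProbabilityMeasure signLaw where
  measure_univ := by
    simp [signLaw, ENNReal.inv_two_add_inv_two]

instance : IsProbabilityMeasure sparseSignLaw where
  measure_univ := by
    rw [← ENNReal.toReal_eq_one_iff]
    simp [sparseSignLaw]
    rw [ENNReal.toReal_add, ENNReal.toReal_add] <;> norm_num [ENNReal.div_eq_top]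

theorem integral_signLaw (f : ℝ → ℝ) : ∫ x, f x ∂signLaw = (f 1 + f (-1)) / 2 := by
  rw [signLaw, integral_add_measure, integral_smul_measure, integral_smul_measure, integral_dirac,
    integral_dirac]
  · simp
    ring
  all_goals exact (integrable_dirac (by simp)).smul_measure (by simp)

theorem integral_sparseSignLaw (f : ℝ → ℝ) :
    ∫ x, f x ∂sparseSignLaw = f 1 / 6 + 2 / 3 * f 0 + f (-1) / 6 := by
  have hi : ∀ (c : ℝ≥0∞) (a : ℝ), c ≠ ⊤ → Integrable f (c • Measure.dirac a) := fun c a hc =>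
    (integrable_dirac (by simp)).smul_measure hc
  have h1 : (1 / 6 : ℝ≥0∞) ≠ ⊤ := by norm_num [ENNReal.div_eq_top]
  have h2 : (2 / 3 : ℝ≥0∞) ≠ ⊤ := by norm_num [ENNReal.div_eq_top]
  rw [sparseSignLaw, integral_add_measure ((hi _ _ h1).add_measure (hi _ _ h2)) (hi _ _ h1),
    integral_add_measure (hi _ _ h1) (hi _ _ h2), integral_smul_measure, integral_smul_measure,
    integral_smul_measure, integral_dirac, integral_dirac, integral_dirac]
  simp
  ring

theorem ae_signLaw : ∀ᵐ x ∂signLaw, x ∈ Set.Icc (-1 : ℝ) 1 := by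
  rw [signLaw, ae_add_measure_iff]
  constructor <;> refine Measure.ae_smul_measure ?_ _ <;>
    exact (ae_dirac_iff measurableSet_Icc).2 (by norm_num)

theorem ae_sparseSignLaw : ∀ᵐ x ∂sparseSignLaw, x ∈ Set.Icc (-1 : ℝ) 1 := by
  rw [sparseSignLaw, ae_add_measure_iff, ae_add_measure_iff]
  refine ⟨⟨?_, ?_⟩, ?_⟩ <;> refine Measure.ae_smul_measure ?_ _ <;>
    exact (ae_dirac_iff measurableSet_Icc).2 (by norm_num)

theorem hasSubgaussianMGF_signLaw : HasSubgaussianMGF id 3 signLaw := by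
  refine hasSubgaussianMGF_mono (hasSubgaussianMGF_of_mem_Icc_of_integral_eq_zero aemeasurable_id
    ae_signLaw (by simp [integral_signLaw])) ?_
  rw [← NNReal.coe_le_coe]
  norm_num

/-- Source of the common proxy 3: Hoeffding's lemma on [-1,1] gives proxy 1, and scaling to unit
variance multiplies it by 3. -/
theorem hasSubgaussianMGF_sparseSignLaw :
    HasSubgaussianMGF id 3 (sparseSignLaw.map (√3 * ·)) := by
  rw [HasSubgaussianMGF.id_map_iff (by fun_prop)]
  have h3 : √3 ^ 2 = 3 := Real.sq_sqrt (by norm_num)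
  refine hasSubgaussianMGF_mono (hasSubgaussianMGF_const_mul
    (hasSubgaussianMGF_of_mem_Icc_of_integral_eq_zero aemeasurable_id ae_sparseSignLaw ?_) (√3)) ?_
  · simp only [id, integral_sparseSignLaw]
    norm_num
  · rw [h3, ← NNReal.coe_le_coe]
    norm_num

theorem hasSubgaussianMGF_gaussianReal : HasSubgaussianMGF id 3 (gaussianReal 0 1) := by
  refine hasSubgaussianMGF_mono (c := 1) ⟨fun t => integrable_exp_mul_gaussianReal t, fun t => ?_⟩
    (by norm_num)
  rw [mgf_id_gaussianReal]
  simp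

theorem integral_sq_gaussianReal : ∫ x, x ^ 2 ∂(gaussianReal 0 1) = 1 := by
  have h := variance_id_gaussianReal (μ := 0) (v := 1)
  rw [variance_of_integral_eq_zero aemeasurable_id (by simp)] at h
  simpa using h

theorem norm_sq_apply_smul (r : ℝ) (M : Matrix (Fin k) (Fin m) ℝ)
    (y : EuclideanSpace ℝ (Fin m)) :
    ‖apply (r • M) y‖ ^ 2 = r ^ 2 * ∑ i, (∑ j, M i j * y j) ^ 2 := by
  rw [EuclideanSpace.real_norm_sq_eq, Finset.mul_sum]
  refine Finset.sum_congr rfl fun i _ => ?_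
  simp [apply, Matrix.mulVec, dotProduct, ← mul_pow, Finset.mul_sum, mul_assoc]

theorem HasIIDEntries.measureReal_lt [IsProbabilityMeasure ν] {U : Ω → Matrix (Fin k) (Fin m) ℝ}
    (h : HasIIDEntries P ν U) (hsub : HasSubgaussianMGF id 3 ν) (hmean : ∫ x, x ∂ν = 0)
    (hvar : ∫ x, x ^ 2 ∂ν = 1) (hk : 0 < k) {y : EuclideanSpace ℝ (Fin m)} (hy : ‖y‖ = 1) {ε : ℝ}
    (hε : 0 ≤ ε) (hε1 : ε ≤ 1) :
    P.real {ω | ε < |‖apply ((1 / √(k : ℝ)) • U ω) y‖ ^ 2 - 1|} ≤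
      2 * Real.exp (-(ε ^ 2 * k / 12000)) := by
  have hk' : (0 : ℝ) < k := by exact_mod_cast hk
  refine (measureReal_mono ?_).trans (h.measureReal_le hsub hmean hvar (y := y) ?_ hε hε1)
  · intro ω hω
    simp only [Set.mem_ofPred_eq, norm_sq_apply_smul, div_pow, one_pow, Real.sq_sqrt hk'.le] at hω ⊢
    set S := ∑ i, (∑ j, U ω i j * y j) ^ 2
    have : |1 / (k : ℝ) * S - 1| * k = |S - k| := by
      rw [← abs_of_pos hk', ← abs_mul, abs_of_pos hk']
      congr 1
      field_simp
    rw [← this]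
    gcongr
  · rw [← EuclideanSpace.real_norm_sq_eq, hy, one_pow]

end Entries

/-! ### Random orthogonal projections, by comparison with a Gaussian vector. -/

section Orthogonal

variable {k m : ℕ}

theorem hasLaw_inner_stdGaussian {v : EuclideanSpace ℝ (Fin m)} (hv : ‖v‖ = 1) :
    HasLaw (fun g => inner ℝ v g) (gaussianReal 0 1) (stdGaussian (EuclideanSpace ℝ (Fin m))) where
  aemeasurable := by fun_prop
  map_eq := by
    have h := IsGaussian.map_eq_gaussianReal (μ := stdGaussian (EuclideanSpace ℝ (Fin m)))
      (innerSL ℝ v)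
    rw [integral_strongDual_stdGaussian, variance_dual_stdGaussian, innerSL_apply_norm, hv] at h
    simpa using h

/-- Jointly Gaussian functionals are independent once uncorrelated, and here the covariances are the
inner products of the v i. -/
theorem iIndepFun_inner_stdGaussian {ι : Type*} [Fintype ι] {v : ι → EuclideanSpace ℝ (Fin m)}
    (hv : Orthonormal ℝ v) :
    iIndepFun (fun i g => inner ℝ (v i) g) (stdGaussian (EuclideanSpace ℝ (Fin m))) := by
  have hid : HasGaussianLaw (id : EuclideanSpace ℝ (Fin m) → _)
      (stdGaussian (EuclideanSpace ℝ (Fin m))) := ⟨by rw [Measure.map_id]; infer_instance⟩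
  refine HasGaussianLaw.iIndepFun_of_covariance_eq_zero
    (hid.map (ContinuousLinearMap.pi fun i => innerSL ℝ (v i))) fun i j hij => ?_
  rw [← covarianceBilin_apply_eq_cov IsGaussian.memLp_two_id, covarianceBilin_stdGaussian]
  exact hv.2 hij

theorem measureReal_stdGaussian_le {ι : Type*} [Fintype ι] {v : ι → EuclideanSpace ℝ (Fin m)}
    (hv : Orthonormal ℝ v) {ε : ℝ} (hε : 0 ≤ ε) (hε1 : ε ≤ 1) :
    (stdGaussian (EuclideanSpace ℝ (Fin m))).real
      {g | ε * Fintype.card ι ≤ |∑ i, (inner ℝ (v i) g) ^ 2 - Fintype.card ι|} ≤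
      2 * Real.exp (-(ε ^ 2 * Fintype.card ι / 12000)) := by
  have hlaw := fun i => hasLaw_inner_stdGaussian (hv.1 i)
  refine measureReal_abs_sum_sq_sub_card_le (iIndepFun_inner_stdGaussian hv) (fun i => ?_)
    (fun i => ?_) hε hε1
  · exact HasSubgaussianMGF.of_map (X := id) (hlaw i).aemeasurable
      (by rw [(hlaw i).map_eq]; exact hasSubgaussianMGF_gaussianReal)
  · rw [← integral_sq_gaussianReal]
    exact (hlaw i).integral_comp (f := fun x => x ^ 2)
      (AEMeasurable.aestronglyMeasurable (by fun_prop))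

/-- The event that `√(m / k) M` distorts the squared norm of `z` by a factor outside
`[1 - ε, 1 + ε]`. -/
def Distorts (M : Fin k → Fin m → ℝ) (ε : ℝ) (z : EuclideanSpace ℝ (Fin m)) : Prop :=
  ε * k * ∑ j, z j ^ 2 < |m * ∑ i, (∑ j, M i j * z j) ^ 2 - k * ∑ j, z j ^ 2|

theorem orthonormal_rows {Q : Matrix (Fin k) (Fin m) ℝ} (hQ : Q * Qᵀ = 1) :
    Orthonormal ℝ fun i => (WithLp.toLp 2 (Q i) : EuclideanSpace ℝ (Fin m)) := by
  rw [orthonormal_iff_ite]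
  intro i j
  have := congrFun (congrFun hQ i) j
  rw [Matrix.one_apply, Matrix.mul_apply] at this
  rw [← this, PiLp.inner_apply]
  exact Finset.sum_congr rfl fun l _ => by simp [mul_comm]

/-- The roles are reversed: Q is fixed and the vector is random. If ‖Qg‖² is within a relative error
ε/3 of k, and ‖g‖² of m, their ratio is within ε of k/m. Since k ≤ m, the tail for ‖g‖² is the
smaller one; 108000 = 9·12000. -/
theorem stdGaussian_distorts_le {Q : Matrix (Fin k) (Fin m) ℝ} (hQ : Q * Qᵀ = 1) (hk : 0 < k)
    {ε : ℝ} (hε : 0 < ε) (hε1 : ε < 1) :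
    (stdGaussian (EuclideanSpace ℝ (Fin m))).real {g | Distorts Q ε g} ≤
      4 * Real.exp (-(ε ^ 2 * k / 108000)) := by
  have hv := orthonormal_rows hQ
  have hkm : k ≤ m := by simpa using hv.linearIndependent.fintype_card_le_finrank
  have hk0 : (0 : ℝ) < k := by exact_mod_cast hk
  have hkm' : (k : ℝ) ≤ m := by exact_mod_cast hkm
  have hm0 : (0 : ℝ) < m := hk0.trans_le hkm'
  have h1 := measureReal_stdGaussian_le hv (ε := ε / 3) (by positivity) (by linarith)
  have h2 := measureReal_stdGaussian_le (EuclideanSpace.basisFun (Fin m) ℝ).orthonormal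
    (ε := ε / 3) (by positivity) (by linarith)
  have hsub : {g | Distorts Q ε g} ⊆
      {g | ε / 3 * Fintype.card (Fin k) ≤ |∑ i, (inner ℝ
        (WithLp.toLp 2 (Q i) : EuclideanSpace ℝ (Fin m)) g) ^ 2 - Fintype.card (Fin k)|} ∪
      {g | ε / 3 * Fintype.card (Fin m) ≤ |∑ j, (inner ℝ
        (EuclideanSpace.basisFun (Fin m) ℝ j) g) ^ 2 - Fintype.card (Fin m)|} := by
    intro g hg
    by_contra hcon
    simp only [Set.mem_union, Set.mem_ofPred_eq, not_or, not_le, Fintype.card_fin] at hcon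
    have e1 : ∀ i, inner ℝ (WithLp.toLp 2 (Q i) : EuclideanSpace ℝ (Fin m)) g =
        ∑ j, Q i j * g j := fun i => by
      rw [PiLp.inner_apply]
      exact Finset.sum_congr rfl fun l _ => by simp [mul_comm]
    have e2 : ∀ j, inner ℝ (EuclideanSpace.basisFun (Fin m) ℝ j) g = g j := fun j => by
      simp [EuclideanSpace.inner_single_left]
    simp only [e1, e2, abs_lt] at hcon
    simp only [Set.mem_ofPred_eq, Distorts] at hg
    set S := ∑ i, (∑ j, Q i j * g j) ^ 2
    set N := ∑ j, g j ^ 2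
    obtain ⟨⟨a1, a2⟩, b1, b2⟩ := hcon
    refine absurd hg (not_lt.2 (abs_le.2 ⟨?_, ?_⟩))
    · have c1 : m * ((1 - ε / 3) * k) ≤ m * S := by gcongr; linarith
      have c2 : (1 - ε) * k * N ≤ (1 - ε) * k * ((1 + ε / 3) * m) := by
        have : 0 ≤ 1 - ε := by linarith
        gcongr
        linarith
      have c3 : (1 - ε) * (1 + ε / 3) * (k * m) ≤ (1 - ε / 3) * (k * m) := by
        gcongr
        nlinarith
      nlinarith
    · have c1 : m * S ≤ m * ((1 + ε / 3) * k) := by gcongr; linarith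
      have c2 : (1 + ε) * k * ((1 - ε / 3) * m) ≤ (1 + ε) * k * N := by
        gcongr
        linarith
      have c3 : (1 + ε / 3) * (k * m) ≤ (1 + ε) * (1 - ε / 3) * (k * m) := by
        gcongr
        nlinarith
      nlinarith
  rw [Fintype.card_fin] at h1 h2
  have hexp : Real.exp (-((ε / 3) ^ 2 * m / 12000)) ≤ Real.exp (-((ε / 3) ^ 2 * k / 12000)) := by
    gcongr
  calc _ ≤ _ := measureReal_mono hsub
    _ ≤ _ := measureReal_union_le _ _
    _ ≤ 2 * Real.exp (-((ε / 3) ^ 2 * k / 12000)) + 2 * Real.exp (-((ε / 3) ^ 2 * m / 12000)) := by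
      simpa only [Fintype.card_fin] using add_le_add h1 h2
    _ ≤ 4 * Real.exp (-((ε / 3) ^ 2 * k / 12000)) := by linarith
    _ = _ := by congr 3; ring

/-- Orthogonal matrices act transitively on spheres. -/
theorem exists_orthogonal_mulVec_eq {x w : Fin m → ℝ} (h : x ⬝ᵥ x = w ⬝ᵥ w) :
    ∃ R ∈ Matrix.orthogonalGroup (Fin m) ℝ, Rᵀ *ᵥ x = w := by
  set v := x - w with hv
  -- Householder reflection exchanging x and w. If x = w, division by zero gives c = 0 and R = 1.
  set c := 2 / (v ⬝ᵥ v) with hc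
  set R : Matrix (Fin m) (Fin m) ℝ := 1 - c • Matrix.vecMulVec v v with hR
  have hT : Rᵀ = R := by
    rw [hR, Matrix.transpose_sub, Matrix.transpose_smul, Matrix.transpose_vecMulVec,
      Matrix.transpose_one]
  have hVV : Matrix.vecMulVec v v * Matrix.vecMulVec v v = (v ⬝ᵥ v) • Matrix.vecMulVec v v := by
    rw [Matrix.vecMulVec_mul_vecMulVec]
    ext i j
    simp [Matrix.vecMulVec_apply]
    ring
  have hvv : v ⬝ᵥ v = 2 * (v ⬝ᵥ x) := by
    simp only [hv, sub_dotProduct, dotProduct_sub, dotProduct_comm w x]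
    linarith
  refine ⟨R, ?_, ?_⟩
  · rw [Matrix.mem_orthogonalGroup_iff, hT, hR, sub_mul, mul_sub, mul_sub, one_mul,
      one_mul, mul_one, Matrix.smul_mul, Matrix.mul_smul, hVV, smul_smul, smul_smul]
    have : c * c * (v ⬝ᵥ v) = 2 * c := by
      rcases eq_or_ne (v ⬝ᵥ v) 0 with h0 | h0
      · simp [hc, h0]
      · rw [mul_assoc, hc, div_mul_cancel₀ _ h0]
        ring
    rw [this, two_mul, add_smul]
    abel
  · rw [hT, hR, Matrix.sub_mulVec, Matrix.one_mulVec, Matrix.smul_mulVec, Matrix.vecMulVec_mulVec]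
    rcases eq_or_ne (v ⬝ᵥ v) 0 with h0 | h0
    · have : v = 0 := dotProduct_self_eq_zero.1 h0
      rw [this]
      simpa [hv, sub_eq_zero] using this
    · have : c * (v ⬝ᵥ x) = 1 := by
        rw [hc, hvv]
        have : v ⬝ᵥ x ≠ 0 := fun h => h0 (by rw [hvv, h, mul_zero])
        field_simp
      ext i
      have h3 : c * (v i * (v ⬝ᵥ x)) = v i := by linear_combination v i * this
      simp only [Pi.sub_apply, Pi.smul_apply, smul_eq_mul, MulOpposite.smul_eq_mul_unop,
        MulOpposite.unop_op, h3]
      simp [hv]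

theorem sum_sq_mulVec (Q : Matrix (Fin k) (Fin m) ℝ) (z : Fin m → ℝ) :
    ∑ i, (∑ j, Q i j * z j) ^ 2 = z ⬝ᵥ (Qᵀ * Q) *ᵥ z := by
  rw [← Matrix.mulVec_mulVec, Matrix.dotProduct_mulVec, Matrix.vecMul_transpose]
  simp [dotProduct, Matrix.mulVec, sq]

variable {Ω : Type*} [MeasurableSpace Ω] {P : Measure Ω}

/-- The event is homogeneous in the vector and sees Q only through QᵀQ, whose law is invariant under
conjugation by an orthogonal R with Rᵀx = g/‖g‖. -/
theorem IsRandomOrthogonalProjection.measure_distorts_eq {Q : Ω → Matrix (Fin k) (Fin m) ℝ}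
    (h : IsRandomOrthogonalProjection P Q) (ε : ℝ) {x g : EuclideanSpace ℝ (Fin m)}
    (hx : ‖x‖ = 1) (hg : g ≠ 0) :
    P {ω | Distorts (Q ω) ε x} = P {ω | Distorts (Q ω) ε g} := by
  have hg0 : 0 < ‖g‖ := norm_pos_iff.2 hg
  have hgs : ∑ j, g j ^ 2 = ‖g‖ ^ 2 := (EuclideanSpace.real_norm_sq_eq g).symm
  have hxs : ∑ j, x j ^ 2 = 1 := by rw [← EuclideanSpace.real_norm_sq_eq, hx, one_pow]
  obtain ⟨R, hR, hRx⟩ := exists_orthogonal_mulVec_eq (x := x.ofLp) (w := ‖g‖⁻¹ • g.ofLp) (by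
    rw [smul_dotProduct, dotProduct_smul]
    simp only [dotProduct, ← sq, hxs, hgs, smul_eq_mul]
    field_simp)
  let B : Set (Fin m → Fin m → ℝ) :=
    {N | ε * k < |m * (x.ofLp ⬝ᵥ Matrix.mulVec (Matrix.of N) x.ofLp) - k|}
  have hB : MeasurableSet B := by
    refine measurableSet_lt measurable_const (Continuous.measurable ?_)
    simp only [dotProduct, Matrix.mulVec, Matrix.of_apply]
    fun_prop
  have key := (h.rotation_invariant R hR).measure_mem_eq hB
  convert key using 2
  · ext ω
    simp only [Distorts, B, Set.mem_ofPred_eq, Set.mem_preimage, hxs, mul_one,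
      sum_sq_mulVec]
    rfl
  · ext ω
    have hq : x.ofLp ⬝ᵥ (R * ((Q ω)ᵀ * Q ω) * Rᵀ) *ᵥ x.ofLp =
        (‖g‖ ^ 2)⁻¹ * (g.ofLp ⬝ᵥ ((Q ω)ᵀ * Q ω) *ᵥ g.ofLp) := by
      rw [← Matrix.mulVec_mulVec, ← Matrix.mulVec_mulVec, Matrix.dotProduct_mulVec,
        ← Matrix.mulVec_transpose, hRx, Matrix.mulVec_smul, smul_dotProduct, dotProduct_smul,
        smul_eq_mul, smul_eq_mul]
      field_simp
    have : Distorts (Q ω) ε g ↔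
        ε * k < |m * (x.ofLp ⬝ᵥ (R * ((Q ω)ᵀ * Q ω) * Rᵀ) *ᵥ x.ofLp) - k| := by
      unfold Distorts
      rw [hq, hgs, sum_sq_mulVec]
      set q := g.ofLp ⬝ᵥ ((Q ω)ᵀ * Q ω) *ᵥ g.ofLp
      have e : m * q - k * ‖g‖ ^ 2 = ‖g‖ ^ 2 * (m * ((‖g‖ ^ 2)⁻¹ * q) - k) := by
        field_simp
      rw [e, abs_mul, abs_of_pos (pow_pos hg0 2), mul_comm]
      exact mul_lt_mul_iff_right₀ (pow_pos hg0 2)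
    exact this

theorem measure_zero_stdGaussian (hm : 0 < m) :
    stdGaussian (EuclideanSpace ℝ (Fin m)) {0} = 0 := by
  have hlaw := hasLaw_inner_stdGaussian
    ((EuclideanSpace.basisFun (Fin m) ℝ).orthonormal.1 ⟨0, hm⟩)
  have h0 : gaussianReal 0 1 {0} = 0 := by
    have := nullSingletonClass_gaussianReal (μ := 0) one_ne_zero
    exact measure_singleton 0
  rw [← hlaw.map_eq, Measure.map_apply_of_aemeasurable hlaw.aemeasurable
    (measurableSet_singleton 0)] at h0
  refine measure_mono_null ?_ h0
  rintro _ rfl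
  simp

theorem IsRandomOrthogonalProjection.measureReal_distorts_le [IsProbabilityMeasure P]
    {Q : Ω → Matrix (Fin k) (Fin m) ℝ}
    (h : IsRandomOrthogonalProjection P Q) (hk : 0 < k) {x : EuclideanSpace ℝ (Fin m)}
    (hx : ‖x‖ = 1) {ε : ℝ} (hε : 0 < ε) (hε1 : ε < 1) :
    P.real {ω | Distorts (Q ω) ε x} ≤ 4 * Real.exp (-(ε ^ 2 * k / 108000)) := by
  have hm : 0 < m := by
    rcases Nat.eq_zero_or_pos m with rfl | hm
    · have : x = 0 := Subsingleton.elim _ _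
      simp [this] at hx
    · exact hm
  set γ := stdGaussian (EuclideanSpace ℝ (Fin m)) with hγ
  let q : Ω → Fin k → Fin m → ℝ := fun ω i j => Q ω i j
  have hq : AEMeasurable q P := aemeasurable_pi_lambda _ fun i =>
    aemeasurable_pi_lambda _ fun j => h.measurable i j
  have : IsProbabilityMeasure (P.map q) := Measure.isProbabilityMeasure_map hq
  let S : Set ((Fin k → Fin m → ℝ) × EuclideanSpace ℝ (Fin m)) := {p | Distorts p.1 ε p.2}
  have hS : MeasurableSet S := by
    simp only [S, Distorts]
    refine measurableSet_lt (Continuous.measurable ?_) (Continuous.measurable ?_) <;> fun_prop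
  have hae : ∀ᵐ M ∂(P.map q), Matrix.of M * (Matrix.of M)ᵀ = 1 := by
    rw [ae_map_iff hq]
    · exact h.orthonormal_rows
    · refine IsClosed.measurableSet (isClosed_eq ?_ continuous_const)
      refine continuous_matrix fun i j => ?_
      simp only [Matrix.mul_apply, Matrix.transpose_apply, Matrix.of_apply]
      fun_prop
  -- The product measure of S is computed in both orders: slices at fixed Q obey the Gaussian bound,
  -- while slices at fixed g ≠ 0 all have the probability sought.
  have hle : (P.map q).prod γ S ≤ ENNReal.ofReal (4 * Real.exp (-(ε ^ 2 * k / 108000))) := by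
    rw [Measure.prod_apply hS]
    calc _ ≤ ∫⁻ _, ENNReal.ofReal (4 * Real.exp (-(ε ^ 2 * k / 108000))) ∂(P.map q) := by
          refine lintegral_mono_ae ?_
          filter_upwards [hae] with M hM
          have := stdGaussian_distorts_le hM hk hε hε1
          rw [← ENNReal.ofReal_toReal (measure_ne_top γ _)]
          exact ENNReal.ofReal_le_ofReal this
      _ = _ := by simp
  have heq : (P.map q).prod γ S = P {ω | Distorts (Q ω) ε x} := by
    rw [Measure.prod_apply_symm hS]
    calc _ = ∫⁻ _, P {ω | Distorts (Q ω) ε x} ∂γ := by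
          refine lintegral_congr_ae ?_
          have hne : ∀ᵐ g ∂γ, g ≠ 0 := by
            rw [ae_iff]
            simpa using measure_zero_stdGaussian hm
          filter_upwards [hne] with g hg
          rw [Measure.map_apply_of_aemeasurable hq (hS.preimage (by fun_prop)),
            h.measure_distorts_eq ε hx hg]
          rfl
      _ = _ := by simp
  rw [heq] at hle
  exact ENNReal.toReal_le_of_le_ofReal (by positivity) hle

end Orthogonal

/-! ### Preservation of norms and inner products for all four kinds of projector. -/

section JohnsonLindenstrauss

variable {Ω : Type*} [MeasurableSpace Ω] {P : Measure Ω} [IsProbabilityMeasure P] {k m : ℕ}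
  {T : Ω → Matrix (Fin k) (Fin m) ℝ}

theorem IsRandomProjector.measureReal_unit_le (hT : IsRandomProjector P T) (hk : 0 < k)
    {u : EuclideanSpace ℝ (Fin m)} (hu : ‖u‖ = 1) {ε : ℝ} (hε : 0 < ε) (hε1 : ε < 1) :
    P.real {ω | ε < |‖apply (T ω) u‖ ^ 2 - 1|} ≤ 4 * Real.exp (-(ε ^ 2 * k / 108000)) := by
  have hk' : (0 : ℝ) < k := by exact_mod_cast hk
  have hexp : 2 * Real.exp (-(ε ^ 2 * k / 12000)) ≤ 4 * Real.exp (-(ε ^ 2 * k / 108000)) := by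
    gcongr
    · norm_num
    · norm_num
  cases hT with
  | orthogonal Q h =>
    refine le_trans (le_of_eq ?_) (h.measureReal_distorts_le hk hu hε hε1)
    congr 1
    ext ω
    simp only [Set.mem_ofPred_eq, Distorts, norm_sq_apply_smul]
    rw [Real.sq_sqrt (by positivity), ← EuclideanSpace.real_norm_sq_eq, hu, one_pow, mul_one,
      mul_one]
    set S := ∑ i, (∑ j, Q ω i j * u j) ^ 2
    have e : m * S - k = k * (m / k * S - 1) := by field_simp
    rw [e, abs_mul, abs_of_pos hk', mul_comm ε]
    exact (mul_lt_mul_iff_right₀ hk').symm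
  | gaussian U h =>
    exact (h.measureReal_lt hasSubgaussianMGF_gaussianReal (by simp) integral_sq_gaussianReal hk hu
      hε.le hε1.le).trans hexp
  | sign U h =>
    exact (h.measureReal_lt hasSubgaussianMGF_signLaw (by simp [integral_signLaw])
      (by simp [integral_signLaw]) hk hu hε.le hε1.le).trans hexp
  | sparseSign U h =>
    have hm : AEMeasurable (fun x : ℝ => √3 * x) sparseSignLaw :=
      (measurable_const_mul _).aemeasurable
    have : IsProbabilityMeasure (sparseSignLaw.map (√3 * ·)) :=
      Measure.isProbabilityMeasure_map hm
    have h3 : √3 ^ 2 = 3 := Real.sq_sqrt (by norm_num)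
    have hmean : ∫ x, x ∂(sparseSignLaw.map (√3 * ·)) = 0 := by
      rw [integral_map hm (by fun_prop), integral_sparseSignLaw]
      ring
    have hvar : ∫ x, x ^ 2 ∂(sparseSignLaw.map (√3 * ·)) = 1 := by
      rw [integral_map hm (by fun_prop), integral_sparseSignLaw]
      ring_nf
      rw [h3]
      norm_num
    have := (h.const_smul (√3)).measureReal_lt hasSubgaussianMGF_sparseSignLaw hmean hvar hk hu
      hε.le hε1.le
    simp_rw [smul_smul] at this
    rw [show 1 / √(k : ℝ) * √3 = √(3 / k) by rw [Real.sqrt_div (by norm_num)]; ring] at this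
    exact this.trans hexp

theorem IsRandomProjector.measureReal_le (hT : IsRandomProjector P T) (hk : 0 < k)
    (z : EuclideanSpace ℝ (Fin m)) {ε : ℝ} (hε : 0 < ε) (hε1 : ε < 1) :
    P.real {ω | ε * ‖z‖ ^ 2 < |‖applyₗ (T ω) z‖ ^ 2 - ‖z‖ ^ 2|} ≤
      4 * Real.exp (-(ε ^ 2 * k / 108000)) := by
  -- z = 0 does occur, as u - v for a vector paired with itself; the strict inequality makes the
  -- event empty.
  rcases eq_or_ne z 0 with rfl | hz
  · simp only [map_zero, norm_zero]
    norm_num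
    positivity
  have hz0 : 0 < ‖z‖ := norm_pos_iff.2 hz
  have hu : ‖‖z‖⁻¹ • z‖ = 1 := by
    rw [norm_smul, norm_inv, norm_norm, inv_mul_cancel₀ hz0.ne']
  refine le_trans (le_of_eq ?_) (hT.measureReal_unit_le hk hu hε hε1)
  congr 1
  ext ω
  simp only [Set.mem_ofPred_eq, ← applyₗ_apply, map_smul, norm_smul, norm_inv, norm_norm]
  have e : ‖applyₗ (T ω) z‖ ^ 2 - ‖z‖ ^ 2 =
      ‖z‖ ^ 2 * ((‖z‖⁻¹ * ‖applyₗ (T ω) z‖) ^ 2 - 1) := by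
    field_simp
  rw [e, abs_mul, abs_of_pos (pow_pos hz0 2), mul_comm ε]
  exact mul_lt_mul_iff_right₀ (pow_pos hz0 2)

/-- Polarization: four times the error is at most ε(‖u+v‖² + ‖u-v‖²) = 4ε. -/
theorem abs_inner_map_sub_le {E F : Type*} [NormedAddCommGroup E] [InnerProductSpace ℝ E]
    [NormedAddCommGroup F] [InnerProductSpace ℝ F] (L : E →ₗ[ℝ] F) {u v : E} (hu : ‖u‖ = 1)
    (hv : ‖v‖ = 1) {ε : ℝ} (h1 : |‖L (u + v)‖ ^ 2 - ‖u + v‖ ^ 2| ≤ ε * ‖u + v‖ ^ 2)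
    (h2 : |‖L (u - v)‖ ^ 2 - ‖u - v‖ ^ 2| ≤ ε * ‖u - v‖ ^ 2) :
    |inner ℝ (L u) (L v) - inner ℝ u v| ≤ ε := by
  rw [map_add] at h1
  rw [map_sub] at h2
  have e1 := norm_add_sq_real u v
  have e2 := norm_sub_sq_real u v
  have e3 := norm_add_sq_real (L u) (L v)
  have e4 := norm_sub_sq_real (L u) (L v)
  rw [hu, hv] at e1 e2
  rw [abs_le] at h1 h2 ⊢
  constructor <;> nlinarith

theorem IsRandomProjector.measureReal_inner_le (hT : IsRandomProjector P T) (hk : 0 < k)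
    {u v : EuclideanSpace ℝ (Fin m)} (hu : ‖u‖ = 1) (hv : ‖v‖ = 1) {ε : ℝ} (hε : 0 < ε)
    (hε1 : ε < 1) :
    P.real {ω | ε < |inner ℝ (applyₗ (T ω) u) (applyₗ (T ω) v) - inner ℝ u v|} ≤
      8 * Real.exp (-(ε ^ 2 * k / 108000)) := by
  calc _ ≤ P.real ({ω | ε * ‖u + v‖ ^ 2 < |‖applyₗ (T ω) (u + v)‖ ^ 2 - ‖u + v‖ ^ 2|} ∪
        {ω | ε * ‖u - v‖ ^ 2 < |‖applyₗ (T ω) (u - v)‖ ^ 2 - ‖u - v‖ ^ 2|}) := by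
        refine measureReal_mono fun ω hω => ?_
        by_contra hcon
        simp only [Set.mem_union, Set.mem_ofPred_eq, not_or, not_lt] at hcon hω
        exact absurd hω (not_lt.2 (abs_inner_map_sub_le _ hu hv hcon.1 hcon.2))
    _ ≤ _ := measureReal_union_le _ _
    _ ≤ 4 * Real.exp (-(ε ^ 2 * k / 108000)) + 4 * Real.exp (-(ε ^ 2 * k / 108000)) :=
        add_le_add (hT.measureReal_le hk _ hε hε1) (hT.measureReal_le hk _ hε hε1)
    _ = _ := by ring

/-- With y = K·exp(-x/2), either y ≤ 1 and p ≤ y² ≤ y, or p ≤ 1 ≤ y. This trades half the exponent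
for the square root of the prefactor. -/
theorem le_mul_exp_half {p K x : ℝ} (hp : p ≤ 1) (hK : 1 ≤ K) (h : p ≤ K ^ 2 * Real.exp (-x)) :
    p ≤ K * Real.exp (-(x / 2)) := by
  have e : K ^ 2 * Real.exp (-x) = (K * Real.exp (-(x / 2))) ^ 2 := by
    rw [mul_pow, ← Real.exp_nat_mul]
    congr 2
    push_cast
    ring
  have h0 : 0 ≤ K * Real.exp (-(x / 2)) := by positivity
  rw [e] at h
  set y := K * Real.exp (-(x / 2))
  rcases le_total y 1 with hy | hy
  · nlinarith
  · linarith

end JohnsonLindenstrauss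

/-! ### Union bound and conclusion. -/

theorem IsRandomProjector.measureReal_apply_notMem_cone_ge {m n k : ℕ}
    (A : Matrix (Fin m) (Fin n) ℝ) {b : EuclideanSpace ℝ (Fin m)} {Δ ε : ℝ} (hb : ‖b‖ = 1)
    (hA : ∀ j, ‖column A j‖ = 1) (hΔ : 0 ≤ Δ) (hd : Δ ≤ Metric.infDist b (cone A)) (hε : 0 < ε)
    (hε' : ε < Δ ^ 2 / (distortion A ^ 2 + 2 * distortion A * √(1 - Δ ^ 2) + 1))
    {Ω : Type*} [MeasurableSpace Ω] {P : Measure Ω} [IsProbabilityMeasure P]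
    {T : Ω → Matrix (Fin k) (Fin m) ℝ} (hT : IsRandomProjector P T) :
    1 - 2 * ((n : ℝ) + 1) * ((n : ℝ) + 2) * Real.exp (-(1 / 216000) * (ε ^ 2 - ε ^ 3) * k)
      ≤ P.real {ω | apply (T ω) b ∉ cone (T ω * A)} := by
  have hn : (0 : ℝ) ≤ n := Nat.cast_nonneg n
  have hK : 1 ≤ 2 * ((n : ℝ) + 1) * (n + 2) := by nlinarith
  rcases Nat.eq_zero_or_pos k with rfl | hk
  · have : 0 ≤ P.real {ω | apply (T ω) b ∉ cone (T ω * A)} := measureReal_nonneg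
    simp only [CharP.cast_eq_zero, mul_zero, Real.exp_zero, mul_one]
    linarith
  have hε1 : ε < 1 := by
    refine hε'.trans_le ((div_le_one ?_).2 ?_) <;>
      have := distortion_nonneg A
    · positivity
    · have h1 := dist_le_one A hb hd
      have : 0 ≤ distortion A ^ 2 + 2 * distortion A * √(1 - Δ ^ 2) := by positivity
      nlinarith
  set bad : Set Ω := {ω | apply (T ω) b ∈ cone (T ω * A)} with hbad
  let w : Option (Fin n) → EuclideanSpace ℝ (Fin m) := fun p => p.elim b (column A)
  have hw : ∀ p, ‖w p‖ = 1 := by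
    rintro (_ | j)
    · exact hb
    · exact hA j
  have hsub : bad ⊆ ⋃ p : Option (Fin n) × Option (Fin n),
      {ω | ε < |inner ℝ (applyₗ (T ω) (w p.1)) (applyₗ (T ω) (w p.2)) - inner ℝ (w p.1) (w p.2)|} := by
    intro ω hω
    by_contra hcon
    simp only [Set.mem_iUnion, Set.mem_ofPred_eq, not_exists, not_lt, Prod.forall] at hcon
    exact apply_notMem_cone A hb hΔ hd hε' (T ω) hcon hω
  -- The union bound gives the prefactor 8(n+1)², enlarged to the square of the desired one so that
  -- `le_mul_exp_half` applies.
  have hbad_le : P.real bad ≤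
      (2 * ((n : ℝ) + 1) * (n + 2)) ^ 2 * Real.exp (-(ε ^ 2 * k / 108000)) := by
    calc P.real bad ≤ _ := measureReal_mono hsub
      _ ≤ ∑ p : Option (Fin n) × Option (Fin n), P.real {ω | ε < |inner ℝ (applyₗ (T ω) (w p.1))
          (applyₗ (T ω) (w p.2)) - inner ℝ (w p.1) (w p.2)|} := measureReal_iUnion_fintype_le _
      _ ≤ ∑ _p : Option (Fin n) × Option (Fin n), 8 * Real.exp (-(ε ^ 2 * k / 108000)) :=
          Finset.sum_le_sum fun p _ => hT.measureReal_inner_le hk (hw _) (hw _) hε hε1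
      _ = 8 * ((n : ℝ) + 1) ^ 2 * Real.exp (-(ε ^ 2 * k / 108000)) := by
          simp
          ring
      _ ≤ _ := by
          gcongr
          rw [mul_pow, mul_pow]
          nlinarith [mul_nonneg (sq_nonneg ((n : ℝ) + 1)) (mul_nonneg hn hn),
            mul_nonneg (sq_nonneg ((n : ℝ) + 1)) hn, sq_nonneg ((n : ℝ) + 1)]
  have hhalf := le_mul_exp_half measureReal_le_one hK hbad_le
  have hexp : Real.exp (-(ε ^ 2 * k / 108000 / 2)) ≤
      Real.exp (-(1 / 216000) * (ε ^ 2 - ε ^ 3) * k) := by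
    gcongr
    have : 0 ≤ ε ^ 3 * k := by positivity
    nlinarith
  -- Subadditivity instead of a complement formula: no measurability of the event is required.
  have hone : 1 ≤ P.real {ω | apply (T ω) b ∉ cone (T ω * A)} + P.real bad := by
    have huniv : {ω | apply (T ω) b ∉ cone (T ω * A)} ∪ bad = Set.univ := by
      ext ω
      simp only [hbad, Set.mem_union, Set.mem_ofPred_eq, Set.mem_univ, iff_true]
      exact (em _).symm
    calc (1 : ℝ) = P.real ({ω | apply (T ω) b ∉ cone (T ω * A)} ∪ bad) := by
          rw [huniv, probReal_univ]
      _ ≤ _ := measureReal_union_le _ _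
  have : 2 * ((n : ℝ) + 1) * (n + 2) * Real.exp (-(ε ^ 2 * k / 108000 / 2)) ≤
      2 * ((n : ℝ) + 1) * (n + 2) * Real.exp (-(1 / 216000) * (ε ^ 2 - ε ^ 3) * k) := by
    gcongr
  linarith

end RandomProjection

theorem theorem3p4 :
    ∃ C : ℝ, 0 < C ∧
      ∀ (m n k : ℕ) (A : Matrix (Fin m) (Fin n) ℝ) (b : EuclideanSpace ℝ (Fin m)) (Δ ε : ℝ),
        ‖b‖ = 1 → (∀ j, ‖RandomProjection.column A j‖ = 1) →
        b ∉ RandomProjection.cone A →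
        0 ≤ Δ → Δ ≤ Metric.infDist b (RandomProjection.cone A) →
        0 < ε →
        ε < Δ ^ 2 / (RandomProjection.distortion A ^ 2
              + 2 * RandomProjection.distortion A * √(1 - Δ ^ 2) + 1) →
        ∀ (Ω : Type*) [MeasurableSpace Ω] (P : Measure Ω) [IsProbabilityMeasure P]
          (T : Ω → Matrix (Fin k) (Fin m) ℝ), RandomProjection.IsRandomProjector P T →
          1 - 2 * ((n : ℝ) + 1) * ((n : ℝ) + 2) * Real.exp (-C * (ε ^ 2 - ε ^ 3) * k)
            ≤ P.real {ω | RandomProjection.apply (T ω) b ∉ RandomProjection.cone (T ω * A)} := by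
  refine ⟨1 / 216000, by norm_num, ?_⟩
  intro m n k A b Δ ε hb hA _ hΔ hd hε hε' Ω _ P _ T hT
  exact hT.measureReal_apply_notMem_cone_ge A hb hA hΔ hd hε hε'
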